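/- Let $G$ be a compact Lie group and let $X$ be a compact $G$-ANR, that is, a compact metrizable $G$-space which is an equivariant retract of an invariant open neighbourhood whenever it is embedded equivariantly as a closed subset of a metrizable $G$-space. Let $A\subseteq X$ be a nonempty closed $G$-invariant subset, and let $f:X\to X$ be a $G$-map which is $G$-homotopic to a $G$-map $h:X\to X$ with $\mathrm{Fix}(h)=A$. Then, with $I=[0,1]$, there is a map $H_A:A\times I\to X$ with the following two properties. * ($C_G1$) $H_A$ is a $G$-homotopy from $f|_A$ to the inclusion $A\hookrightarrow X$. * ($C_G2$) For every isotropy subgroup $K$ of $X$ whose Weyl group $WK=NK/K$ is finite, and for every essential $WK$-fixed point class $F$ of $f^K=f|_{X^K}:X^K\to X^K$, where $X^K$ is the set of points fixed by $K$, there is a path $\alpha:I\to X^K$ with $\alpha(0)\in F$ and $\alpha(1)\in A^K=A\cap X^K$ which is homotopic in $X^K$, relative to the endpoints, to the concatenation of the paths $t\mapsto f^K(\alpha(t))$ and $t\mapsto H_A(\alpha(1),t)$. Here two fixed points $x,y$ of $f^K$ are Nielsen equivalent if there is a path $\sigma$ in $X^K$ from $x$ to $y$ that is homotopic to $f^K\circ\sigma$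 relative to the endpoints, and the equivalence classes are the ordinary fixed point classes of $f^K$. The points $x,y$ are in the same $WK$-fixed point class if $y$ is Nielsen equivalent to $wx$ for some $w\in WK$. The index of a $WK$-fixed point class is the sum of the fixed point indices of the finitely many ordinary fixed point classes that it consists of, and the class is essential if its index is nonzero. -/

import Mathlib

open scoped unitInterval Topology ContDiff Manifold

universe u v

/-! ### The fixed point index on compact absolute neighbourhood retracts -/

/-- `d` is the Brouwer degree `deg(ψ, Ω, 0)` of a map `ψ` which is continuous on the closure of the
bounded open set `Ω ⊆ ℝⁿ` and has no zero on the boundary of `Ω`. This is Heinz' analytic form of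
the degree: for every smooth `g` which is uniformly close to `ψ` on the closure of `Ω`, and every
smooth `ρ` of total mass one which is supported close to the origin,
`d = ∫_Ω ρ(g(x)) det Dg(x) dx`. (The number `d` is an integer, but that is a theorem.) -/
def HasBrouwerDegree {n : ℕ} (ψ : EuclideanSpace ℝ (Fin n) → EuclideanSpace ℝ (Fin n))
    (Ω : Set (EuclideanSpace ℝ (Fin n))) (d : ℝ) : Prop :=
  ∃ δ : ℝ, 0 < δ ∧
    ∀ g : EuclideanSpace ℝ (Fin n) → EuclideanSpace ℝ (Fin n), ContDiff ℝ ∞ g →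
      (∀ x ∈ closure Ω, ‖g x - ψ x‖ < δ) →
    ∀ ρ : EuclideanSpace ℝ (Fin n) → ℝ, ContDiff ℝ ∞ ρ →
      Function.support ρ ⊆ Metric.ball 0 δ → ∫ y, ρ y = 1 →
    ∫ x in Ω, ρ (g x) * (fderiv ℝ g x).det = d

/-- `d` is the fixed point index of the isolated set `F` of fixed points of the self-map `f` of the
compact absolute neighbourhood retract `Z`.

`V` is an isolating neighbourhood of `F`. The index of `f` on `V` is computed by finite dimensional
approximation: if `U ⊆ ℝⁿ` is open and `s : Z → U`, `r : U → Z` are maps such that `r ∘ s` is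
sufficiently close to the identity of `Z`, then the index is the index of the map `s ∘ f ∘ r` on the
open set `r⁻¹(V)` of `ℝⁿ`, which is the degree of `x ↦ x - s (f (r x))` on any bounded open `Ω`
whose closure lies in `r⁻¹(V)` and which contains all the fixed points of `s ∘ f ∘ r` in `r⁻¹(V)`.
(The topology of `C(Z, Z)` is that of uniform convergence; the map `r` is only used on `U`.) -/
def HasFixedPointIndex {Z : Type u} [TopologicalSpace Z] (f : C(Z, Z)) (F : Set Z) (d : ℝ) : Prop :=
  ∃ V : Set Z, IsOpen V ∧ F ⊆ V ∧ closure V ∩ {z | f z = z} = F ∧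
    ∀ᶠ e in 𝓝 (ContinuousMap.id Z),
      ∀ (n : ℕ) (U : Set (EuclideanSpace ℝ (Fin n))) (s : Z → EuclideanSpace ℝ (Fin n))
        (r : EuclideanSpace ℝ (Fin n) → Z),
      IsOpen U → Continuous s → (∀ z, s z ∈ U) → ContinuousOn r U → (∀ z, r (s z) = e z) →
      ∀ Ω : Set (EuclideanSpace ℝ (Fin n)), IsOpen Ω → Bornology.IsBounded Ω →
        (∀ x ∈ closure Ω, x ∈ U ∧ r x ∈ V) →
        (∀ x ∈ U, r x ∈ V → s (f (r x)) = x → x ∈ Ω) →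
      HasBrouwerDegree (fun x => x - s (f (r x))) Ω d

open Classical in
/-- The fixed point index of an isolated set `F` of fixed points of `f : Z → Z`, for `Z` a compact
absolute neighbourhood retract. -/
noncomputable def fixedPointIndex {Z : Type u} [TopologicalSpace Z] (f : C(Z, Z)) (F : Set Z) : ℝ :=
  if h : ∃! d : ℝ, HasFixedPointIndex f F d then h.choose else 0

/-! ### Fixed point classes -/

/-- The fixed points `x` and `y` of `f` are Nielsen equivalent: there is a path `p` from `x` to `y`
such that `f ∘ p` and `p` are homotopic relative to the endpoints. -/
def NielsenEquiv {Z : Type u} [TopologicalSpace Z] (f : C(Z, Z)) (x y : Z) : Prop :=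
  ∃ (hx : f x = x) (hy : f y = y) (p : Path x y),
    Path.Homotopic p ((p.map f.continuous).cast hx.symm hy.symm)

/-- `W` is an (ordinary) fixed point class of `f`. -/
def IsFixedPointClass {Z : Type u} [TopologicalSpace Z] (f : C(Z, Z)) (W : Set Z) : Prop :=
  ∃ x, f x = x ∧ W = {y | NielsenEquiv f x y}

section Equivariant

variable (G : Type v) [Group G] {X : Type u} [TopologicalSpace X] [MulAction G X]

/-- Equivariance of a map which is defined on a subset `S` of a `G`-space. -/
def IsEquivariantOn {Y : Type*} [MulAction G Y] (S : Set Y) (φ : S → X) : Prop :=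
  ∀ (g : G) (y z : S), (z : Y) = g • (y : Y) → φ z = g • φ y

variable (X) in
/-- The `G`-space `X` is a `G`-ANR: it is metrizable and, whenever it is embedded equivariantly as a
closed subset of a metrizable `G`-space `Y`, it is an equivariant retract of some invariant open
neighbourhood in `Y`. -/
def IsGANR [TopologicalSpace G] : Prop :=
  TopologicalSpace.MetrizableSpace X ∧
  ∀ (Y : Type u) [TopologicalSpace Y] [TopologicalSpace.MetrizableSpace Y] [MulAction G Y]
    [ContinuousSMul G Y] (e : X → Y),
    Topology.IsClosedEmbedding e → (∀ (g : G) (x : X), e (g • x) = g • e x) →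
    ∃ (U : Set Y) (r : C(U, X)), IsOpen U ∧ (∀ (g : G), ∀ y ∈ U, g • y ∈ U) ∧
      IsEquivariantOn G U r ∧ ∀ x : X, ∃ hx : e x ∈ U, r ⟨e x, hx⟩ = x

/-- `f` and `h` are `G`-homotopic. -/
def IsGHomotopic (f h : C(X, X)) : Prop :=
  ∃ H : ContinuousMap.Homotopy f h, ∀ (t : I) (g : G) (x : X), H (t, g • x) = g • H (t, x)

variable {G}

/-- The Weyl group `WK = NK / K` is finite. -/
def FiniteWeylGroup (K : Subgroup G) : Prop :=
  Finite (Subgroup.normalizer (K : Set G) ⧸ K.subgroupOf (Subgroup.normalizer (K : Set G)))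

/-- `K` is an isotropy subgroup of the `G`-space `X`. -/
def IsIsotropySubgroup (X : Type u) [MulAction G X] (K : Subgroup G) : Prop :=
  ∃ x : X, MulAction.stabilizer G x = K

/-- The map `f^K : X^K → X^K` induced by a `G`-map `f`. -/
def fixedMap (f : C(X, X)) (hf : ∀ (g : G) (x : X), f (g • x) = g • f x) (K : Subgroup G) :
    C(MulAction.fixedPoints K X, MulAction.fixedPoints K X) where
  toFun x := ⟨f x, fun k => by
    have hk : (k : G) • (x : X) = x := x.2 k
    change (k : G) • f x = f x
    rw [← hf, hk]⟩
  continuous_toFun := by fun_prop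

/-- The fixed points `x` and `y` of a `WK`-map `φ : X^K → X^K` are in the same `WK`-fixed point class:
`y` is Nielsen equivalent to `αx` for some `α` in `WK`. The coset `nK` acts on `X^K` as `n`. -/
def WeylNielsenEquiv (K : Subgroup G)
    (φ : C(MulAction.fixedPoints K X, MulAction.fixedPoints K X))
    (x y : MulAction.fixedPoints K X) : Prop :=
  ∃ n ∈ Subgroup.normalizer (K : Set G), ∃ z : MulAction.fixedPoints K X,
    (z : X) = n • (x : X) ∧ NielsenEquiv φ z y

/-- `F` is a `WK`-fixed point class of `φ : X^K → X^K`. -/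
def IsWeylFixedPointClass (K : Subgroup G)
    (φ : C(MulAction.fixedPoints K X, MulAction.fixedPoints K X))
    (F : Set (MulAction.fixedPoints K X)) : Prop :=
  ∃ x, φ x = x ∧ F = {y | WeylNielsenEquiv K φ x y}

/-- The index of a `WK`-fixed point class: the sum of the indices of the (finitely many) ordinary
fixed point classes it consists of. -/
noncomputable def weylIndex (K : Subgroup G)
    (φ : C(MulAction.fixedPoints K X, MulAction.fixedPoints K X))
    (F : Set (MulAction.fixedPoints K X)) : ℝ :=
  ∑ᶠ W ∈ {W : Set (MulAction.fixedPoints K X) | IsFixedPointClass φ W ∧ W ⊆ F},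
    fixedPointIndex φ W

variable (G) in
/-- Condition `(C_G1)` asks for an element of this type: a `G`-homotopy `H_A : A × I → X` from
`f|_A` to the inclusion of `A` in `X`. -/
structure GHomotopyToInclusion (f : C(X, X)) (A : Set X) where
  /-- The homotopy. -/
  toHomotopy : ContinuousMap.Homotopy (f.restrict A) (⟨Subtype.val, continuous_subtype_val⟩ : C(A, X))
  /-- Each stage of the homotopy is equivariant. -/
  equivariant : ∀ t : I, IsEquivariantOn G A (fun a => toHomotopy (t, a))

/-- The path `t ↦ H_A^K(a, t)` in `X^K` from `f^K(a)` to `a`, for `a ∈ A^K`. -/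
def GHomotopyToInclusion.trace {f : C(X, X)} {A : Set X} (HA : GHomotopyToInclusion G f A)
    (hf : ∀ (g : G) (x : X), f (g • x) = g • f x) (K : Subgroup G)
    (a : MulAction.fixedPoints K X) (ha : (a : X) ∈ A) : Path (fixedMap f hf K a) a where
  toFun t := ⟨HA.toHomotopy (t, ⟨a, ha⟩), fun k => by
    have hk : (k : G) • (a : X) = a := a.2 k
    exact (HA.equivariant t k ⟨a, ha⟩ ⟨a, ha⟩ hk.symm).symm⟩
  continuous_toFun := by fun_prop
  source' := by
    apply Subtype.ext
    simp [fixedMap]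
  target' := by
    apply Subtype.ext
    simp

/-- Condition `(C_G2)` for `f`, relative to `A` and to the `G`-homotopy `H_A` of `(C_G1)`: for every
isotropy subgroup `K` with finite Weyl group and every essential `WK`-fixed point class `F` of `f^K`
there is a path `α` in `X^K` from a point of `F` to a point of `A^K` which is homotopic in `X^K`,
relative to the endpoints, to the concatenation of `f^K ∘ α` and `t ↦ H_A^K(α(1), t)`. -/
def ConditionCG2 {f : C(X, X)} (hf : ∀ (g : G) (x : X), f (g • x) = g • f x) {A : Set X}
    (HA : GHomotopyToInclusion G f A) : Prop :=
  ∀ K : Subgroup G, IsIsotropySubgroup X K → FiniteWeylGroup K →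
  ∀ F : Set (MulAction.fixedPoints K X), IsWeylFixedPointClass K (fixedMap f hf K) F →
    weylIndex K (fixedMap f hf K) F ≠ 0 →
  ∃ (x a : MulAction.fixedPoints K X) (hx : fixedMap f hf K x = x) (ha : (a : X) ∈ A)
    (α : Path x a), x ∈ F ∧
    Path.Homotopic α
      ((((α.map (fixedMap f hf K).continuous).cast hx.symm rfl).trans (HA.trace hf K a ha)))

end Equivariant

/-! Let `H` be the given `G`-homotopy from `f` to `h`. Since `h` fixes `A` pointwise, the
restriction of `H` to `A` is the required `H_A`, and by equivariance `H` restricts to a homotopy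
from `f^K` to `h^K` on `X^K`. An essential `WK`-class contains an ordinary class `W` of nonzero
index. Consider the points of `X^K × I` where `H` coincides with the projection to `X^K`, divided
into Nielsen type classes; `W` is the bottom slice of one of them. If this class misses the top,
homotopy invariance gives `W` index zero. Hence it contains some `(a, 1)` with `h a = a`, so `a ∈
A`. Projecting to `X^K` a path in `X^K × I` that relates a point of `W` to `(a, 1)` gives `α`: the
path itself is homotopic to `α` at level zero followed by the vertical segment over `a`, and `H`
sends the latter path to `f ∘ α` followed by the trace of `a`.

Three facts carry this. The degree vanishes when zeros disappear along a homotopy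
(`hasBrouwerDegree_zero_of_homotopy`), by Stokes for the closed pullback of `ρ dy` multiplied by a
cutoff. A class that misses the top has index zero
(`ContinuousMap.Homotopy.hasFixedPointIndex_zero`), by transporting the homotopy to Euclidean space.
The space `X^K` is locally equiconnected (`IsGANR.locallyEquiconnected_fixedPoints`), which makes
coincidence classes relatively open. -/

/-! ### Homotopy invariance of the degree -/

section Degree

open MeasureTheory

/-- The determinant with respect to the standard basis, as a continuous alternating map. -/
noncomputable def detForm (n : ℕ) :
    EuclideanSpace ℝ (Fin n) [⋀^Fin n]→L[ℝ] ℝ :=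
  { (EuclideanSpace.basisFun (Fin n) ℝ).toBasis.det with
    cont := by
      change Continuous fun v : Fin n → EuclideanSpace ℝ (Fin n) =>
        (EuclideanSpace.basisFun (Fin n) ℝ).toBasis.det v
      simp only [Module.Basis.det_apply]
      refine Continuous.matrix_det (continuous_pi fun i => continuous_pi fun j => ?_)
      simp only [Module.Basis.toMatrix_apply, OrthonormalBasis.coe_toBasis_repr_apply,
        EuclideanSpace.basisFun_repr]
      fun_prop }

theorem detForm_map_basis {n : ℕ}
    (M : EuclideanSpace ℝ (Fin n) →L[ℝ] EuclideanSpace ℝ (Fin n)) :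
    detForm n (fun j => M (EuclideanSpace.basisFun (Fin n) ℝ j)) = M.det := by
  have h := (EuclideanSpace.basisFun (Fin n) ℝ).toBasis.det_comp M.toLinearMap
    (EuclideanSpace.basisFun (Fin n) ℝ).toBasis
  rw [Module.Basis.det_self, mul_one] at h
  convert h using 1
  change (EuclideanSpace.basisFun (Fin n) ℝ).toBasis.det _ = _
  congr 1

/-- Forms of degree `n + 1` on an `n`-dimensional space vanish. -/
theorem ContinuousAlternatingMap.eq_zero_of_finrank_lt {n : ℕ}
    (η : EuclideanSpace ℝ (Fin n) [⋀^Fin (n + 1)]→L[ℝ] ℝ) : η = 0 := by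
  ext v
  refine η.toAlternatingMap.map_linearDependent v fun hv => ?_
  have := hv.fintype_card_le_finrank
  simp at this

/-- The pullback of the form `ρ dy` is closed. -/
theorem sum_fderiv_pullback_eq_zero {n : ℕ} {P : Type*} [NormedAddCommGroup P] [NormedSpace ℝ P]
    {K : P → EuclideanSpace ℝ (Fin n)} (hK : ContDiff ℝ ∞ K)
    {ρ : EuclideanSpace ℝ (Fin n) → ℝ} (hρ : ContDiff ℝ ∞ ρ) (v : Fin (n + 1) → P) (p : P) :
    ∑ i : Fin (n + 1), (-1) ^ i.val •
      fderiv ℝ (fun q => ρ (K q) * detForm n (fun j => fderiv ℝ K q (i.removeNth v j))) p (v i)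
      = 0 := by
  have hω : ∀ y, DifferentiableAt ℝ (fun y => ρ y • detForm n) y := fun y =>
    ((hρ.differentiable (by simp)) y).smul_const _
  have hdK : ContDiff ℝ ∞ (fderiv ℝ K) := hK.fderiv_right (by simp)
  -- Exterior differentiation commutes with pullback, and `d(ρ dy)` has degree `n + 1`, so it
  -- vanishes.
  have h1 := extDeriv_pullback (r := ∞) (hω (K p)) hK.contDiffAt (by simpa using ENat.LEInfty.out)
  rw [ContinuousAlternatingMap.eq_zero_of_finrank_lt (extDeriv _ _)] at h1
  have h2 := congrArg (fun η => η v) h1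
  rw [extDeriv_apply] at h2
  · exact h2
  · have a1 : DifferentiableAt ℝ (fun q => (fun y => ρ y • detForm n) (K q)) p :=
      (hω (K p)).comp p (hK.differentiable (by simp) p)
    have := a1.continuousAlternatingMapCompContinuousLinearMap (hdK.differentiable (by simp) p)
    exact this

/-! ### Integrals of divergences -/

section Divergence

variable {E : Type*} [NormedAddCommGroup E] [NormedSpace ℝ E]

theorem HasCompactSupport.slice {Y : Type*} [TopologicalSpace Y] [T2Space Y] {W : Type*}
    [TopologicalSpace W] [T2Space W] {J : Y × W → ℝ} (hJ : HasCompactSupport J) (t : W) :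
    HasCompactSupport fun x => J (x, t) :=
  HasCompactSupport.of_support_subset_isCompact (hJ.isCompact.image continuous_fst) fun x hx =>
    ⟨(x, t), subset_tsupport _ hx, rfl⟩

theorem fderiv_slice {F : Type*} [NormedAddCommGroup F] [NormedSpace ℝ F] {f : E × ℝ → F}
    {x : E} {t : ℝ} (hf : DifferentiableAt ℝ f (x, t)) :
    fderiv ℝ (fun y => f (y, t)) x = (fderiv ℝ f (x, t)).comp (ContinuousLinearMap.inl ℝ E ℝ) :=
  (hf.hasFDerivAt.comp (f := fun y => (y, t)) x (hasFDerivAt_prodMk_left x t)).fderiv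

variable [FiniteDimensional ℝ E] [MeasurableSpace E] [BorelSpace E] (μ : Measure E)
  [μ.IsAddHaarMeasure]

/-- Integration by parts against the constant function `1`. -/
theorem integral_fderiv_apply_eq_zero {u : E → ℝ} (hu : ContDiff ℝ 1 u) (hc : HasCompactSupport u)
    (w : E) : ∫ x, fderiv ℝ u x w ∂μ = 0 := by
  have hd : Continuous fun x => fderiv ℝ u x w := (hu.continuous_fderiv (by simp)).clm_apply
    continuous_const
  have h := integral_mul_fderiv_eq_neg_fderiv_mul_of_integrable (μ := μ) (f := fun _ : E => (1 : ℝ))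
    (g := u) (v := w) (by simp)
    (by simpa using hd.integrable_of_hasCompactSupport (hc.fderiv_apply ℝ w))
    (by simpa using hu.continuous.integrable_of_hasCompactSupport hc)
    (fun x _ => differentiableAt_const _) (fun x _ => hu.differentiable (by simp) x)
  simpa using h

/-- If the time derivative of `u` is the divergence of a compactly supported vector field, then
the integral of `u` is constant in time. -/
theorem integral_slice_eq_of_fderiv_eq_sum {ι : Type*} (s : Finset ι) {u : E × ℝ → ℝ}
    (hu : ContDiff ℝ 1 u) (huc : HasCompactSupport u) {J : ι → E × ℝ → ℝ}
    (hJ : ∀ i, ContDiff ℝ 1 (J i)) (hJc : ∀ i, HasCompactSupport (J i)) (c : ι → ℝ) (w : ι → E)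
    (h : ∀ x, ∀ t ∈ Set.Icc (0 : ℝ) 1,
      fderiv ℝ u (x, t) (0, 1) = ∑ i ∈ s, c i * fderiv ℝ (J i) (x, t) (w i, 0)) :
    ∫ x, u (x, 0) ∂μ = ∫ x, u (x, 1) ∂μ := by
  have hdu : Continuous fun p => fderiv ℝ u p (0, 1) :=
    (hu.continuous_fderiv (by simp)).clm_apply continuous_const
  have hslice : ∀ t, Integrable (fun x => u (x, t)) μ := fun t =>
    (hu.continuous.comp (by fun_prop)).integrable_of_hasCompactSupport (huc.slice t)
  have h1 : ∀ x, u (x, 1) - u (x, 0) = ∫ t in Set.Ioc (0 : ℝ) 1, fderiv ℝ u (x, t) (0, 1) := by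
    intro x
    rw [← intervalIntegral.integral_of_le zero_le_one]
    symm
    apply intervalIntegral.integral_eq_sub_of_hasDerivAt (f := fun t => u (x, t))
    · intro t _
      have := (hu.differentiable (by simp) (x, t)).hasFDerivAt.comp_hasDerivAt t
        ((hasDerivAt_const t x).prodMk (hasDerivAt_id t))
      exact this
    · exact (hdu.comp (by fun_prop : Continuous fun t : ℝ => (x, t))).intervalIntegrable _ _
  have h2 : ∀ t ∈ Set.Ioc (0 : ℝ) 1, ∫ x, fderiv ℝ u (x, t) (0, 1) ∂μ = 0 := by
    intro t ht
    have hz : ∀ i, Continuous fun p => fderiv ℝ (J i) p (w i, 0) := fun i =>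
      ((hJ i).continuous_fderiv (by simp)).clm_apply continuous_const
    have hd : ∀ i x, fderiv ℝ (fun y => J i (y, t)) x (w i) = fderiv ℝ (J i) (x, t) (w i, 0) := by
      intro i x
      rw [fderiv_slice ((hJ i).differentiable (by simp) (x, t))]
      simp
    simp only [h _ t ⟨ht.1.le, ht.2⟩]
    rw [integral_finsetSum]
    · refine Finset.sum_eq_zero fun i _ => ?_
      rw [integral_const_mul]
      simp only [← hd]
      rw [integral_fderiv_apply_eq_zero μ (u := fun y => J i (y, t)) ((hJ i).comp (by fun_prop))
        ((hJc i).slice t), mul_zero]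
    · intro i _
      refine Integrable.const_mul ?_ _
      exact ((hz i).comp (by fun_prop)).integrable_of_hasCompactSupport
        (((hJc i).fderiv_apply ℝ _).slice t)
  have h3 : ∫ x, (u (x, 1) - u (x, 0)) ∂μ = 0 := by
    simp only [h1]
    rw [integral_integral_swap]
    · rw [setIntegral_congr_fun measurableSet_Ioc h2]
      simp
    · have : Integrable (fun p : E × ℝ => fderiv ℝ u p (0, 1)) (μ.prod volume) :=
        hdu.integrable_of_hasCompactSupport (huc.fderiv_apply ℝ _)
      rw [show μ.prod (volume.restrict (Set.Ioc (0 : ℝ) 1)) =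
        (μ.prod volume).restrict (Set.univ ×ˢ Set.Ioc (0 : ℝ) 1) by
          rw [← Measure.prod_restrict, Measure.restrict_univ]]
      exact this.restrict
  rw [integral_sub (hslice 1) (hslice 0)] at h3
  linarith

end Divergence

/-- Homotopy invariance of the integral of a pulled back form. The cutoff `χ` is locally constant
where the pulled back form does not vanish. -/
theorem integral_cutoff_pullback_eq {n : ℕ}
    {K : EuclideanSpace ℝ (Fin n) × ℝ → EuclideanSpace ℝ (Fin n)} (hK : ContDiff ℝ ∞ K)
    {ρ : EuclideanSpace ℝ (Fin n) → ℝ} (hρ : ContDiff ℝ ∞ ρ)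
    {χ : EuclideanSpace ℝ (Fin n) × ℝ → ℝ} (hχ : ContDiff ℝ ∞ χ) (hc : HasCompactSupport χ)
    (h : ∀ x, ∀ t ∈ Set.Icc (0 : ℝ) 1, ρ (K (x, t)) ≠ 0 → fderiv ℝ χ (x, t) = 0) :
    ∫ x, χ (x, 0) * (ρ (K (x, 0)) * (fderiv ℝ (fun y => K (y, 0)) x).det) =
      ∫ x, χ (x, 1) * (ρ (K (x, 1)) * (fderiv ℝ (fun y => K (y, 1)) x).det) := by
  -- `v` lists the time direction and then the standard basis; `V i` is the pulled back form on `v`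
  -- with entry `i` omitted. Thus `V 0` is the integrand of the degree and the other `V i` are the
  -- components of its flux.
  set v : Fin (n + 1) → EuclideanSpace ℝ (Fin n) × ℝ :=
    Fin.cons (0, 1) fun j => (EuclideanSpace.basisFun (Fin n) ℝ j, 0) with hv
  set V : Fin (n + 1) → EuclideanSpace ℝ (Fin n) × ℝ → ℝ := fun i q =>
    ρ (K q) * detForm n (fun j => fderiv ℝ K q (i.removeNth v j)) with hV
  have hVs : ∀ i, ContDiff ℝ 1 (V i) := by
    intro i
    have hdK : ContDiff ℝ ∞ (fderiv ℝ K) := hK.fderiv_right (by simp)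
    have h1 : ContDiff ℝ ∞ fun q => detForm n (fun j => fderiv ℝ K q (i.removeNth v j)) :=
      (detForm n).toContinuousMultilinearMap.contDiff.comp
        (contDiff_pi.2 fun j => hdK.clm_apply contDiff_const)
    exact ((hρ.comp hK).mul h1).of_le (by simp)
  have hχ1 : ContDiff ℝ 1 χ := hχ.of_le (by simp)
  have hJs : ∀ i, ContDiff ℝ 1 fun q => χ q * V i q := fun i => hχ1.mul (hVs i)
  have hJc : ∀ i, HasCompactSupport fun q => χ q * V i q := fun i => hc.mul_right
  -- Every `V i` has the factor `ρ ∘ K`, so the term of the product rule with the derivative of `χ`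
  -- vanishes.
  have hfd : ∀ i x, ∀ t ∈ Set.Icc (0 : ℝ) 1, ∀ w,
      fderiv ℝ (fun q => χ q * V i q) (x, t) w = χ (x, t) * fderiv ℝ (V i) (x, t) w := by
    intro i x t ht w
    rw [fderiv_fun_mul (hχ1.differentiable (by simp) _) ((hVs i).differentiable (by simp) _)]
    by_cases h0 : ρ (K (x, t)) = 0
    · simp [hV, h0]
    · simp [h x t ht h0]
  have hdet : ∀ x t, V 0 (x, t) = ρ (K (x, t)) * (fderiv ℝ (fun y => K (y, t)) x).det := by
    intro x t
    rw [← detForm_map_basis, fderiv_slice (hK.differentiable (by simp) (x, t))]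
    simp only [hV, hv]
    congr 2
  have := integral_slice_eq_of_fderiv_eq_sum volume (Finset.univ : Finset (Fin n)) (hJs 0) (hJc 0)
    (fun j : Fin n => hJs j.succ) (fun j => hJc j.succ) (fun j => -(-1) ^ (j.succ : Fin (n + 1)).val)
    (fun j => EuclideanSpace.basisFun (Fin n) ℝ j) ?_
  · simpa only [hdet] using this
  · intro x t ht
    have h0 := sum_fderiv_pullback_eq_zero hK hρ v (x, t)
    rw [Fin.sum_univ_succ] at h0
    simp only [hfd _ x t ht]
    have h1 : fderiv ℝ (V 0) (x, t) (0, 1) = - ∑ j : Fin n, (-1) ^ (j.succ : Fin (n + 1)).val *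
        fderiv ℝ (V j.succ) (x, t) (EuclideanSpace.basisFun (Fin n) ℝ j, 0) := by
      rw [eq_neg_iff_add_eq_zero]
      simpa [hv, hV] using h0
    rw [h1, mul_neg, Finset.mul_sum, ← Finset.sum_neg_distrib]
    refine Finset.sum_congr rfl fun j _ => ?_
    ring

/-! ### Smooth approximation, cutoffs and vanishing of the degree -/

theorem IsCompact.exists_pos_le_norm {Y F : Type*} [TopologicalSpace Y] [NormedAddCommGroup F]
    {C : Set Y} (hC : IsCompact C) {f : Y → F} (hf : ContinuousOn f C) (h : ∀ y ∈ C, f y ≠ 0) :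
    ∃ ε > 0, ∀ y ∈ C, ε ≤ ‖f y‖ := by
  rcases C.eq_empty_or_nonempty with rfl | hne
  · exact ⟨1, one_pos, by simp⟩
  · obtain ⟨y, hy, hmin⟩ := hC.exists_isMinOn hne hf.norm
    exact ⟨‖f y‖, norm_pos_iff.2 (h y hy), fun z hz => hmin hz⟩

/-- A continuous map on a closed subset of a finite dimensional space is uniformly close to a
smooth map. -/
theorem ContinuousOn.exists_contDiff_norm_sub_lt {P F : Type*} [NormedAddCommGroup P]
    [NormedSpace ℝ P] [FiniteDimensional ℝ P] [NormedAddCommGroup F] [NormedSpace ℝ F] {L : Set P}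
    (hL : IsClosed L) {f : P → F} (hf : ContinuousOn f L) {δ : ℝ} (hδ : 0 < δ) :
    ∃ g : P → F, ContDiff ℝ ∞ g ∧ ∀ p ∈ L, ‖g p - f p‖ < δ := by
  -- The constraint is vacuous off `L`, so a smooth partition of unity on all of `P` applies.
  let t : P → Set F := fun p => {c | p ∈ L → ‖c - f p‖ < δ}
  have ht : ∀ p, Convex ℝ (t p) := by
    intro p
    by_cases hp : p ∈ L
    · simpa [t, hp, Metric.ball, dist_eq_norm] using convex_ball (f p) δ
    · simpa [t, hp] using convex_univ
  have hloc : ∀ p, ∃ c, ∀ᶠ y in 𝓝 p, c ∈ t y := by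
    intro p
    by_cases hp : p ∈ L
    · refine ⟨f p, ?_⟩
      have := (hf p hp).eventually (Metric.ball_mem_nhds (f p) hδ)
      filter_upwards [eventually_nhdsWithin_iff.1 this] with y hy hyL
      simpa [dist_eq_norm, norm_sub_rev] using hy hyL
    · refine ⟨0, ?_⟩
      filter_upwards [hL.isOpen_compl.mem_nhds hp] with y hy hyL
      exact absurd hyL hy
  obtain ⟨g, hg⟩ := exists_contMDiffMap_forall_mem_convex_of_local_const (n := ⊤) 𝓘(ℝ, P) ht hloc
  exact ⟨g, g.contMDiff.contDiff, hg⟩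

/-- A smooth cutoff function. -/
theorem IsCompact.exists_cutoff {P : Type*} [NormedAddCommGroup P] [NormedSpace ℝ P]
    [FiniteDimensional ℝ P] {S O : Set P} (hS : IsCompact S) (hO : IsOpen O) (hSO : S ⊆ O) :
    ∃ (χ : P → ℝ) (N L : Set P), ContDiff ℝ ∞ χ ∧ IsOpen N ∧ IsCompact L ∧ S ⊆ N ∧ L ⊆ O ∧
      (∀ p ∈ N, χ p = 1) ∧ (∀ p ∉ L, χ p = 0) := by
  obtain ⟨L, hL, hSL, hLO⟩ := exists_compact_between hS hO hSO
  obtain ⟨L', hL', hSL', hLL'⟩ := exists_compact_between hS isOpen_interior hSL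
  obtain ⟨χ, hχ, -, hsupp, hone⟩ := exists_contMDiff_support_eq_eq_one_iff (n := ⊤) 𝓘(ℝ, P)
    (isOpen_interior (s := L)) hL'.isClosed hLL'
  refine ⟨χ, interior L', L, hχ.contDiff, isOpen_interior, hL, hSL', hLO,
    fun p hp => (hone p).1 (interior_subset hp), fun p hp => ?_⟩
  by_contra h
  exact hp (interior_subset (hsupp ▸ h : p ∈ interior L))

theorem IsOpen.fderiv_eq_zero_of_const {P : Type*} [NormedAddCommGroup P] [NormedSpace ℝ P]
    {N : Set P} (hN : IsOpen N) {χ : P → ℝ} {c : ℝ} (h : ∀ p ∈ N, χ p = c) {p : P} (hp : p ∈ N) :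
    fderiv ℝ χ p = 0 := by
  have : χ =ᶠ[𝓝 p] fun _ => c := by
    filter_upwards [hN.mem_nhds hp] with q hq using h q hq
  rw [this.fderiv_eq]
  simp

/-- The linear homotopy between two smooth maps. -/
theorem integral_cutoff_pullback_eq_of_segment {n : ℕ}
    {g₀ g₁ : EuclideanSpace ℝ (Fin n) → EuclideanSpace ℝ (Fin n)} (hg₀ : ContDiff ℝ ∞ g₀)
    (hg₁ : ContDiff ℝ ∞ g₁) {ρ : EuclideanSpace ℝ (Fin n) → ℝ} (hρ : ContDiff ℝ ∞ ρ)
    {χ : EuclideanSpace ℝ (Fin n) → ℝ} (hχ : ContDiff ℝ ∞ χ) (hc : HasCompactSupport χ)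
    (h : ∀ x, ∀ t ∈ Set.Icc (0 : ℝ) 1, ρ ((1 - t) • g₀ x + t • g₁ x) ≠ 0 → fderiv ℝ χ x = 0) :
    ∫ x, χ x * (ρ (g₀ x) * (fderiv ℝ g₀ x).det) =
      ∫ x, χ x * (ρ (g₁ x) * (fderiv ℝ g₁ x).det) := by
  -- The time cutoff makes the support compact; with radii 2 and 3 it is 1 near `[0, 1]`.
  let η : ContDiffBump (0 : ℝ) := ⟨2, 3, by norm_num, by norm_num⟩
  have hη : ∀ t ∈ Set.Icc (0 : ℝ) 1, η =ᶠ[𝓝 t] fun _ => 1 := by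
    intro t ht
    have : Metric.ball (0 : ℝ) 2 ∈ 𝓝 t := Metric.isOpen_ball.mem_nhds (by
      simp only [Metric.mem_ball, dist_zero_right, Real.norm_eq_abs, abs_lt]
      constructor <;> linarith [ht.1, ht.2])
    filter_upwards [this] with s hs
    exact η.one_of_mem_closedBall (Metric.ball_subset_closedBall hs)
  have h0 : η 0 = 1 := (hη 0 (by simp)).self_of_nhds
  have h1 : η 1 = 1 := (hη 1 (by simp)).self_of_nhds
  have key := integral_cutoff_pullback_eq
    (K := fun p => (1 - p.2) • g₀ p.1 + p.2 • g₁ p.1) (χ := fun p => χ p.1 * η p.2) (ρ := ρ)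
    (((contDiff_const.sub contDiff_snd).smul (hg₀.comp contDiff_fst)).add
      (contDiff_snd.smul (hg₁.comp contDiff_fst))) hρ
    ((hχ.comp contDiff_fst).mul (η.contDiff.comp contDiff_snd)) ?_ ?_
  · simpa [h0, h1] using key
  · refine HasCompactSupport.of_support_subset_isCompact
      (hc.isCompact.prod η.hasCompactSupport.isCompact) fun p hp => ?_
    exact ⟨subset_tsupport _ (left_ne_zero_of_mul hp), subset_tsupport _ (right_ne_zero_of_mul hp)⟩
  · intro x t ht hne
    have hx := h x t ht hne
    have : (fun p : EuclideanSpace ℝ (Fin n) × ℝ => χ p.1 * η p.2) =ᶠ[𝓝 (x, t)]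
        fun p => χ p.1 := by
      filter_upwards [continuous_snd.continuousAt.eventually (hη t ht)] with p hp
      simp [hp]
    rw [this.fderiv_eq]
    have := ((hχ.differentiable (by simp) x).hasFDerivAt.comp (x, t)
      (hasFDerivAt_fst (𝕜 := ℝ) (p := (x, t)))).fderiv
    change fderiv ℝ (fun p : EuclideanSpace ℝ (Fin n) × ℝ => χ p.1) (x, t) = _ at this
    rw [this, hx]
    simp

/-- The degree vanishes if the zeros of the map disappear during a homotopy. -/
theorem hasBrouwerDegree_zero_of_homotopy {n : ℕ}
    {ψ : EuclideanSpace ℝ (Fin n) → EuclideanSpace ℝ (Fin n)} {Ω : Set (EuclideanSpace ℝ (Fin n))}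
    (hΩo : IsOpen Ω) (hΩ : Bornology.IsBounded Ω) (hψ : ContinuousOn ψ (closure Ω))
    {g : EuclideanSpace ℝ (Fin n) × ℝ → EuclideanSpace ℝ (Fin n)}
    {O : Set (EuclideanSpace ℝ (Fin n) × ℝ)} (hO : IsOpen O) (hg : ContinuousOn g O)
    (hS : IsCompact {p | p ∈ O ∧ p.2 ∈ Set.Icc (0 : ℝ) 1 ∧ g p = 0})
    (h1 : ∀ x, (x, 1) ∈ O → g (x, 1) ≠ 0) (h0 : ∀ x, (x, 0) ∈ O → x ∈ Ω ∧ g (x, 0) = ψ x)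
    (hz : ∀ x ∈ closure Ω, ψ x = 0 → (x, 0) ∈ O) : HasBrouwerDegree ψ Ω 0 := by
  -- No zero lies at time 1, so the cutoff may be supported in `t < 1`; it then vanishes identically
  -- at time 1.
  obtain ⟨χ, N, L, hχ, hN, hL, hSN, hLO, hχN, hχL⟩ := hS.exists_cutoff
    (O := O ∩ {p | p.2 < 1}) (hO.inter (isOpen_lt continuous_snd continuous_const)) (by
      rintro ⟨x, t⟩ ⟨hp, ht, hp0⟩
      refine ⟨hp, lt_of_le_of_ne ht.2 ?_⟩
      rintro (rfl : t = 1)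
      exact h1 x hp hp0)
  have hsuppχ : HasCompactSupport χ := HasCompactSupport.intro hL hχL
  have hgL : ContinuousOn g L := hg.mono fun p hp => (hLO hp).1
  have hdχ : ∀ p, p ∈ N ∨ p ∉ L → fderiv ℝ χ p = 0 := by
    rintro p (hp | hp)
    · exact hN.fderiv_eq_zero_of_const hχN hp
    · exact hL.isClosed.isOpen_compl.fderiv_eq_zero_of_const hχL hp
  obtain ⟨ε₁, hε₁, hb₁⟩ := IsCompact.exists_pos_le_norm
    (C := (L ∩ {p | p.2 ∈ Set.Icc (0 : ℝ) 1}) \ N) (f := g)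
    ((hL.inter_right (isClosed_Icc.preimage continuous_snd)).diff hN)
    (hgL.mono fun p hp => hp.1.1)
    (fun p hp hp0 => hp.2 (hSN ⟨(hLO hp.1.1).1, hp.1.2, hp0⟩))
  have hc0 : Continuous fun x : EuclideanSpace ℝ (Fin n) => (x, (0 : ℝ)) := by fun_prop
  obtain ⟨ε₂, hε₂, hb₂⟩ := IsCompact.exists_pos_le_norm
    (C := closure Ω \ {x | (x, (0 : ℝ)) ∈ N}) (f := ψ)
    (hΩ.isCompact_closure.diff (hN.preimage hc0)) (hψ.mono Set.sdiff_subset)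
    (fun x hx hx0 => hx.2 (hSN ⟨hz x hx.1 hx0, by simp,
      ((h0 x (hz x hx.1 hx0)).2.trans hx0)⟩))
  -- One `δ` pays for the approximation and one for the support of `ρ`: where the map is at least `2
  -- * δ` in norm, `ρ` of the approximation is zero.
  set δ := min ε₁ ε₂ / 2 with hδ
  have hδpos : 0 < δ := by positivity
  have hδ₁ : 2 * δ ≤ ε₁ := by rw [hδ]; linarith [min_le_left ε₁ ε₂]
  have hδ₂ : 2 * δ ≤ ε₂ := by rw [hδ]; linarith [min_le_right ε₁ ε₂]
  have hL0 : ∀ x, (x, (0 : ℝ)) ∈ L → x ∈ Ω := fun x hx => (h0 x (hLO hx).1).1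
  refine ⟨δ, hδpos, fun g₀ hg₀ hclose ρ hρ hρsupp _ => ?_⟩
  have hρlt : ∀ y, ρ y ≠ 0 → ‖y‖ < δ := fun y hy => by simpa using hρsupp hy
  obtain ⟨k, hk, hkg⟩ := hgL.exists_contDiff_norm_sub_lt hL.isClosed hδpos
  have hnearΩ : ∀ x ∈ closure Ω, ∀ y, ‖y - ψ x‖ < δ → ρ y ≠ 0 → (x, (0 : ℝ)) ∈ N := by
    intro x hx y hy hρy
    by_contra hxN
    have a1 := hb₂ x ⟨hx, hxN⟩
    have a2 := hρlt y hρy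
    have a3 : ‖ψ x‖ ≤ ‖y‖ + ‖y - ψ x‖ := by
      simpa using norm_sub_le y (y - ψ x)
    linarith
  have hkψ : ∀ x, (x, (0 : ℝ)) ∈ L → ‖k (x, 0) - ψ x‖ < δ := fun x hx => by
    rw [← (h0 x (hLO hx).1).2]
    exact hkg _ hx
  have step0 : ∫ x in Ω, ρ (g₀ x) * (fderiv ℝ g₀ x).det =
      ∫ x, χ (x, 0) * (ρ (g₀ x) * (fderiv ℝ g₀ x).det) := by
    rw [← integral_indicator hΩo.measurableSet]
    congr 1
    ext x
    by_cases hx : x ∈ Ω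
    · rw [Set.indicator_of_mem hx]
      by_cases hρx : ρ (g₀ x) = 0
      · simp [hρx]
      · rw [hχN _ (hnearΩ x (subset_closure hx) _ (hclose x (subset_closure hx)) hρx), one_mul]
    · rw [Set.indicator_of_notMem hx, hχL _ fun h => hx (hL0 x h), zero_mul]
  have step1 : ∫ x, χ (x, 0) * (ρ (g₀ x) * (fderiv ℝ g₀ x).det) =
      ∫ x, χ (x, 0) * (ρ (k (x, 0)) * (fderiv ℝ (fun y => k (y, 0)) x).det) := by
    refine integral_cutoff_pullback_eq_of_segment hg₀ (hk.comp (by fun_prop)) hρ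
      (hχ.comp (by fun_prop)) (hsuppχ.slice 0) fun x t ht hne => ?_
    rw [fderiv_slice (hχ.differentiable (by simp) (x, 0)), hdχ, ContinuousLinearMap.zero_comp]
    by_cases hx : (x, (0 : ℝ)) ∈ L
    · left
      have hxΩ := subset_closure (hL0 x hx)
      refine hnearΩ x hxΩ _ ?_ hne
      have := (convex_ball (ψ x) δ) (x := g₀ x) (by simpa [dist_eq_norm] using hclose x hxΩ)
        (y := k (x, 0)) (by simpa [dist_eq_norm] using hkψ x hx)
        (sub_nonneg.2 ht.2) ht.1 (by ring)
      simpa [dist_eq_norm] using this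
    · exact Or.inr hx
  -- On `L` outside `N` the map `k` has norm at least `δ`, so `ρ ∘ k` vanishes there; elsewhere `χ`
  -- is locally constant.
  have step2 : ∫ x, χ (x, 0) * (ρ (k (x, 0)) * (fderiv ℝ (fun y => k (y, 0)) x).det) =
      ∫ x, χ (x, 1) * (ρ (k (x, 1)) * (fderiv ℝ (fun y => k (y, 1)) x).det) := by
    refine integral_cutoff_pullback_eq hk hρ hχ hsuppχ fun x t ht hne => hdχ _ ?_
    by_contra hcon
    push Not at hcon
    have a1 := hb₁ (x, t) ⟨⟨hcon.2, ht⟩, hcon.1⟩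
    have a2 := hρlt _ hne
    have a3 := hkg _ hcon.2
    have a4 : ‖g (x, t)‖ ≤ ‖k (x, t)‖ + ‖k (x, t) - g (x, t)‖ := by
      simpa using norm_sub_le (k (x, t)) (k (x, t) - g (x, t))
    linarith
  rw [step0, step1, step2]
  have hχ1 : ∀ x, χ (x, 1) = 0 := fun x => hχL _ fun h => lt_irrefl (1 : ℝ) (hLO h).2
  simp [hχ1]

end Degree

/-! ### Local equiconnectedness and homotopies of paths -/

/-- Points close to each other are joined by a path, which depends continuously on the points and
is constant if the points are equal. -/
def LocallyEquiconnected (Z : Type*) [TopologicalSpace Z] : Prop :=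
  ∃ (D : Set (Z × Z)) (l : (Z × Z) × I → Z), IsOpen D ∧ (∀ z, (z, z) ∈ D) ∧
    ContinuousOn l (D ×ˢ Set.univ) ∧ (∀ p ∈ D, l (p, 0) = p.1) ∧ (∀ p ∈ D, l (p, 1) = p.2) ∧
    ∀ z t, l ((z, z), t) = z

theorem locallyEquiconnected_unitInterval :
    ∃ l : (I × I) × I → I, Continuous l ∧ (∀ p, l (p, 0) = p.1) ∧ (∀ p, l (p, 1) = p.2) ∧
    ∀ z t, l ((z, z), t) = z := by
  refine ⟨fun q => ⟨(1 - q.2 : ℝ) * q.1.1 + q.2 * q.1.2, ?_⟩, ?_, ?_, ?_, ?_⟩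
  · exact (convex_Icc (0 : ℝ) 1) q.1.1.2 q.1.2.2 (sub_nonneg.2 q.2.2.2) q.2.2.1 (by ring)
  · fun_prop
  · intro p; ext; simp
  · intro p; ext; simp
  · intro z t; ext; simp only; ring

theorem LocallyEquiconnected.prod_unitInterval {Z : Type*} [TopologicalSpace Z]
    (hZ : LocallyEquiconnected Z) : LocallyEquiconnected (Z × I) := by
  obtain ⟨D, l, hD, hdiag, hl, hl0, hl1, hlc⟩ := hZ
  obtain ⟨m, hm, hm0, hm1, hmc⟩ := locallyEquiconnected_unitInterval
  refine ⟨{p | (p.1.1, p.2.1) ∈ D}, fun q => (l ((q.1.1.1, q.1.2.1), q.2), m ((q.1.1.2, q.1.2.2), q.2)),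
    hD.preimage (by fun_prop), fun z => hdiag _, ?_, ?_, ?_, ?_⟩
  · refine ContinuousOn.prodMk ?_ (hm.comp (by fun_prop)).continuousOn
    exact hl.comp (by fun_prop) fun q hq => ⟨hq.1, trivial⟩
  · intro p hp
    exact Prod.ext (hl0 _ hp) (hm0 _)
  · intro p hp
    exact Prod.ext (hl1 _ hp) (hm1 _)
  · intro z t
    exact Prod.ext (hlc _ _) (hmc _ _)

/-- The homotopy moves `p s` to `q s` along `l`. It fixes the endpoints because `l` is constant on
the diagonal. -/
theorem Path.homotopic_of_forall_mem {Z : Type*} [TopologicalSpace Z] {D : Set (Z × Z)}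
    {l : (Z × Z) × I → Z} (hl : ContinuousOn l (D ×ˢ Set.univ)) (hl0 : ∀ p ∈ D, l (p, 0) = p.1)
    (hl1 : ∀ p ∈ D, l (p, 1) = p.2) (hlc : ∀ z t, l ((z, z), t) = z) {x y : Z} {p q : Path x y}
    (h : ∀ s, (p s, q s) ∈ D) : p.Homotopic q :=
  ⟨{ toFun := fun us => l ((p us.2, q us.2), us.1)
     continuous_toFun := hl.comp_continuous (by fun_prop) fun us => ⟨h _, trivial⟩
     map_zero_left := fun s => hl0 _ (h s)
     map_one_left := fun s => hl1 _ (h s)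
     prop' := by
      rintro u s (rfl | rfl)
      · simp [hlc]
      · simp [hlc] }⟩

theorem Path.homotopic_unitInterval {s t : I} (p q : Path s t) : p.Homotopic q := by
  obtain ⟨m, hm, hm0, hm1, hmc⟩ := locallyEquiconnected_unitInterval
  exact Path.homotopic_of_forall_mem (D := Set.univ) hm.continuousOn (fun p _ => hm0 p)
    (fun p _ => hm1 p) hmc fun s => trivial

/-- Only the values of the paths matter, which absorbs all casts of endpoints. -/
theorem Path.Homotopic.congr_apply {Z : Type*} [TopologicalSpace Z] {a b a' b' : Z}
    {p q : Path a b} {p' q' : Path a' b'} (h : p.Homotopic q) (ha : a = a') (hb : b = b')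
    (hp : ∀ t, p t = p' t) (hq : ∀ t, q t = q' t) : p'.Homotopic q' := by
  subst ha hb
  rwa [← Path.ext (funext hp), ← Path.ext (funext hq)]

/-- Paths in `Z × I` are determined up to homotopy by their projections to `Z`. -/
theorem Path.homotopic_of_map_fst {Z : Type*} [TopologicalSpace Z] {a b : Z × I} {p q : Path a b}
    (h : (p.map continuous_fst).Homotopic (q.map continuous_fst)) : p.Homotopic q := by
  have h2 := Path.homotopic_unitInterval (p.map continuous_snd) (q.map continuous_snd)
  obtain ⟨F⟩ := h
  obtain ⟨F₂⟩ := h2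
  exact ⟨Path.Homotopic.prodHomotopy F F₂⟩

/-! ### Coincidence classes -/

section Coincidence

variable {P Z : Type*} [TopologicalSpace P] [TopologicalSpace Z]

/-- The coincidence points `p` and `q` of `φ` and `π` are joined by a path whose images under `φ` and
`π` are homotopic relative to the endpoints. -/
def CoincidenceEquiv (φ π : C(P, Z)) (p q : P) : Prop :=
  ∃ (hp : φ p = π p) (hq : φ q = π q) (γ : Path p q),
    Path.Homotopic (γ.map π.continuous) ((γ.map φ.continuous).cast hp.symm hq.symm)

variable {φ π : C(P, Z)}

theorem CoincidenceEquiv.symm {p q : P} (h : CoincidenceEquiv φ π p q) :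
    CoincidenceEquiv φ π q p := by
  obtain ⟨hp, hq, γ, ⟨F⟩⟩ := h
  exact ⟨hq, hp, γ.symm, ⟨F.symm₂⟩⟩

theorem CoincidenceEquiv.trans {p q r : P} (h : CoincidenceEquiv φ π p q)
    (h' : CoincidenceEquiv φ π q r) : CoincidenceEquiv φ π p r := by
  obtain ⟨hp, hq, γ, hγ⟩ := h
  obtain ⟨hq', hr, γ', hγ'⟩ := h'
  refine ⟨hp, hr, γ.trans γ', ?_⟩
  have := hγ.hcomp hγ'
  rw [← Path.map_trans] at this
  convert this using 1
  ext s
  simp [Path.trans_apply]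

/-- Coincidence classes are open in the coincidence set. -/
theorem LocallyEquiconnected.eventually_coincidenceEquiv (hP : LocallyEquiconnected P)
    (hZ : LocallyEquiconnected Z) {p : P} (hp : φ p = π p) :
    ∀ᶠ q in 𝓝 p, φ q = π q → CoincidenceEquiv φ π p q := by
  obtain ⟨D, l, hD, hdiag, hl, hl0, hl1, hlc⟩ := hZ
  obtain ⟨D', l', hD', hdiag', hl', hl0', hl1', hlc'⟩ := hP
  have hcont : ∀ s : I, ContinuousAt (fun qs : P × I => l' ((p, qs.1), qs.2)) (p, s) := by
    intro s
    refine ContinuousAt.comp (g := l') (f := fun qs : P × I => ((p, qs.1), qs.2)) ?_ (by fun_prop)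
    exact hl'.continuousAt ((hD'.prod isOpen_univ).mem_nhds ⟨hdiag' p, trivial⟩)
  -- For `q = p` the connecting path is constant and both images are `π p`; compactness of `I`
  -- extends membership in `D` to nearby `q`.
  have h1 : ∀ᶠ q in 𝓝 p, ∀ s ∈ (Set.univ : Set I),
      (π (l' ((p, q), s)), φ (l' ((p, q), s))) ∈ D := by
    refine isCompact_univ.eventually_forall_of_forall_eventually fun s _ => ?_
    have hc : ContinuousAt (fun qs : P × I =>
        (π (l' ((p, qs.1), qs.2)), φ (l' ((p, qs.1), qs.2)))) (p, s) :=
      (π.continuous.continuousAt.comp (hcont s)).prodMk (φ.continuous.continuousAt.comp (hcont s))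
    refine hc.eventually (hD.mem_nhds ?_)
    simp only [hlc', hp]
    exact hdiag _
  have h2 : ∀ᶠ q in 𝓝 p, (p, q) ∈ D' :=
    (Continuous.prodMk_right p).continuousAt.eventually (hD'.mem_nhds (hdiag' p))
  filter_upwards [h1, h2] with q hq hqD hφq
  let γ : Path p q :=
    { toFun := fun s => l' ((p, q), s)
      continuous_toFun := hl'.comp_continuous (by fun_prop) fun s => ⟨hqD, trivial⟩
      source' := hl0' _ hqD
      target' := hl1' _ hqD }
  exact ⟨hp, hφq, γ, Path.homotopic_of_forall_mem hl hl0 hl1 hlc fun s => hq s trivial⟩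

/-- The classes partition the closed coincidence set into relatively open pieces, so a class and the
union of the other classes are disjoint closed sets. They can then be separated by open sets. -/
theorem LocallyEquiconnected.isClosed_coincidenceClass [T2Space Z] (hP : LocallyEquiconnected P)
    (hZ : LocallyEquiconnected Z) (p : P) : IsClosed {q | CoincidenceEquiv φ π p q} := by
  rw [← isOpen_compl_iff, isOpen_iff_mem_nhds]
  intro q hq
  by_cases h : φ q = π q
  · filter_upwards [hP.eventually_coincidenceEquiv hZ h] with q' hq' hpq'
    have hpq' : CoincidenceEquiv φ π p q' := hpq'
    exact hq (hpq'.trans (hq' hpq'.2.1).symm)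
  · have : IsOpen {q | φ q ≠ π q} := isOpen_ne_fun φ.continuous π.continuous
    filter_upwards [this.mem_nhds h] with q' hq' hpq'
    exact hq' hpq'.2.1

theorem LocallyEquiconnected.isClosed_compl_coincidenceClass [T2Space Z]
    (hP : LocallyEquiconnected P) (hZ : LocallyEquiconnected Z) (p : P) :
    IsClosed {q | φ q = π q ∧ ¬ CoincidenceEquiv φ π p q} := by
  rw [← isOpen_compl_iff, isOpen_iff_mem_nhds]
  intro q hq
  by_cases h : φ q = π q
  · have hpq : CoincidenceEquiv φ π p q := by
      by_contra hpq
      exact hq ⟨h, hpq⟩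
    filter_upwards [hP.eventually_coincidenceEquiv hZ h] with q' hq' hpq'
    exact hpq'.2 (hpq.trans (hq' hpq'.1))
  · have : IsOpen {q | φ q ≠ π q} := isOpen_ne_fun φ.continuous π.continuous
    filter_upwards [this.mem_nhds h] with q' hq' hpq'
    exact hq' hpq'.1

end Coincidence

/-! ### Homotopies and fixed point classes -/

section Homotopy

variable {Z : Type u} [TopologicalSpace Z] {f h : C(Z, Z)}

/-- A homotopy as a map defined on `Z × I`. -/
def ContinuousMap.Homotopy.swapped (H : f.Homotopy h) : C(Z × I, Z) :=
  ⟨fun p => H (p.2, p.1), by fun_prop⟩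

/-- The path `t ↦ H (a, t)` followed by a fixed point `a` of the last stage. -/
def ContinuousMap.Homotopy.track (H : f.Homotopy h) (a : Z) (ha : h a = a) : Path (f a) a where
  toFun t := H (t, a)
  source' := by simp
  target' := by simp [ha]

/-- Since `I` is contractible, a path in `Z × I` with both ends at level 0 can be pushed down to
level 0, where the homotopy is `f`. -/
theorem ContinuousMap.Homotopy.coincidenceEquiv_zero_iff (H : f.Homotopy h) {x y : Z} :
    CoincidenceEquiv H.swapped ⟨Prod.fst, continuous_fst⟩ (x, 0) (y, 0) ↔ NielsenEquiv f x y := by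
  constructor
  · rintro ⟨hx, hy, γ, hγ⟩
    refine ⟨by simpa [swapped] using hx, by simpa [swapped] using hy, γ.map continuous_fst, ?_⟩
    have h1 : γ.Homotopic ((γ.map continuous_fst).prod (Path.refl 0)) :=
      Path.homotopic_of_map_fst (Path.Homotopic.refl _)
    refine (hγ.trans ((h1.map H.swapped).pathCast hx.symm hy.symm)).congr_apply rfl rfl
      (fun t => rfl) fun t => H.apply_zero _
  · rintro ⟨hx, hy, p, hp⟩
    refine ⟨by simpa [swapped] using hx, by simpa [swapped] using hy, p.prod (Path.refl 0), ?_⟩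
    exact hp.congr_apply rfl rfl (fun t => rfl) fun t => (H.apply_zero _).symm

/-- If a fixed point class of `f` is related to a fixed point class of `h` by the homotopy, then
there is a path which is homotopic to its image under the homotopy. -/
theorem ContinuousMap.Homotopy.exists_path_of_coincidenceEquiv (H : f.Homotopy h) {x a : Z}
    (hc : CoincidenceEquiv H.swapped ⟨Prod.fst, continuous_fst⟩ (x, 0) (a, 1)) (hx : f x = x)
    (ha : h a = a) : ∃ α : Path x a, α.Homotopic
      (((α.map f.continuous).cast hx.symm rfl).trans (H.track a ha)) := by
  obtain ⟨hx1, ha1, γ, hγ⟩ := hc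
  let α : Path x a := γ.map continuous_fst
  let τ : Path (0 : I) 1 := ⟨⟨id, continuous_id⟩, rfl, rfl⟩
  -- Both paths have the same projection to `Z` up to a constant tail: run along `α` at level 0,
  -- then rise vertically over `a`.
  have h1 : γ.Homotopic ((α.prod (Path.refl 0)).trans ((Path.refl a).prod τ)) := by
    refine Path.homotopic_of_map_fst ?_
    have h2 : α.Homotopic (α.trans (Path.refl a)) := ⟨(Path.Homotopy.transRefl α).symm⟩
    refine h2.congr_apply rfl rfl (fun t => rfl) fun t => ?_
    simp only [Path.trans_apply, Path.map_coe, Function.comp_apply]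
    split_ifs <;> simp
  refine ⟨α, (hγ.trans ((h1.map H.swapped).pathCast hx1.symm ha1.symm)).congr_apply rfl rfl
    (fun t => rfl) fun t => ?_⟩
  simp only [Path.cast_coe, Path.map_coe, Function.comp_apply, Path.trans_apply]
  split_ifs
  · simp [swapped]
  · simp [swapped, track, τ]

/-- A fixed point class which is not related to a fixed point class of `h` has index zero. -/
theorem ContinuousMap.Homotopy.hasFixedPointIndex_zero [CompactSpace Z] [T2Space Z]
    (hZ : LocallyEquiconnected Z) (H : f.Homotopy h) {x : Z}
    (hno : ∀ a, ¬ CoincidenceEquiv H.swapped ⟨Prod.fst, continuous_fst⟩ (x, 0) (a, 1)) :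
    HasFixedPointIndex f {y | NielsenEquiv f x y} 0 := by
  set Φ := H.swapped with hΦ
  have hΦ0 : ∀ z, Φ (z, 0) = f z := fun z => H.apply_zero z
  set T : Set (Z × I) := {q | CoincidenceEquiv Φ ⟨Prod.fst, continuous_fst⟩ (x, 0) q} with hT
  have hTc : IsClosed T := hZ.prod_unitInterval.isClosed_coincidenceClass hZ _
  have hRc := hZ.prod_unitInterval.isClosed_compl_coincidenceClass hZ
    (φ := Φ) (π := ⟨Prod.fst, continuous_fst⟩) (x, 0)
  -- `S` isolates the class `T` from all other coincidences; its slice at level 0 is the isolating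
  -- neighbourhood for the index.
  obtain ⟨S, hSo, hTS, hSR⟩ := normal_exists_closure_subset hTc hRc.isOpen_compl
    fun q hq hq' => hq'.2 hq
  have hS : ∀ q ∈ closure S, Φ q = q.1 → q ∈ T := fun q hq hq' => by
    by_contra hqT
    exact hSR hq ⟨hq', hqT⟩
  have hQ : IsCompact (closure S \ S ∪ closure S ∩ {q | q.2 = 1}) :=
    (isClosed_closure.isCompact.diff hSo).union
      (isClosed_closure.inter (isClosed_singleton.preimage continuous_snd)).isCompact
  have hQΦ : ∀ q ∈ closure S \ S ∪ closure S ∩ {q | q.2 = 1}, Φ q ≠ q.1 := by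
    rintro ⟨z, t⟩ (hq | ⟨hq, ht⟩) heq
    · exact hq.2 (hTS (hS _ hq.1 heq))
    · obtain rfl : t = 1 := ht
      exact hno z (hS _ hq heq)
  refine ⟨{z | (z, 0) ∈ S}, hSo.preimage (by fun_prop), fun y hy =>
    hTS (H.coincidenceEquiv_zero_iff.2 hy), ?_, ?_⟩
  · ext y
    constructor
    · rintro ⟨hy, hfy⟩
      have hcl : (y, (0 : I)) ∈ closure S :=
        map_mem_closure (f := fun z => (z, (0 : I))) (by fun_prop) hy fun z hz => hz
      exact H.coincidenceEquiv_zero_iff.1 (hS _ hcl ((hΦ0 y).trans hfy))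
    · intro hy
      exact ⟨subset_closure (hTS (H.coincidenceEquiv_zero_iff.2 hy)), hy.2.1⟩
  -- On the compact set consisting of `closure S \ S` and the top of `closure S` there are no
  -- coincidences, and this persists for `e` close to the identity.
  have hev : ∀ᶠ e in 𝓝 (ContinuousMap.id Z),
      ∀ q ∈ closure S \ S ∪ closure S ∩ {q | q.2 = 1}, e (Φ q) ≠ q.1 := by
    refine hQ.eventually_forall_of_forall_eventually fun q hq => ?_
    have : IsOpen {p : C(Z, Z) × (Z × I) | p.1 (Φ p.2) ≠ p.2.1} :=
      isOpen_ne_fun (by fun_prop) (by fun_prop)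
    exact this.mem_nhds (by simpa using hQΦ q hq)
  filter_upwards [hev] with e he n U s r hU hs hsU hr hrs Ω hΩo hΩb hΩU hΩ
  have heS : ∀ q ∈ closure S, e (Φ q) = q.1 → q ∈ S ∧ q.2 ≠ 1 := fun q hq heq => by
    by_contra hcon
    rw [not_and_or, not_not] at hcon
    exact he q (hcon.imp (fun h => ⟨hq, h⟩) fun h => ⟨hq, h⟩) heq
  let κ : EuclideanSpace ℝ (Fin n) × ℝ → Z × I := fun p => (r p.1, Set.projIcc 0 1 zero_le_one p.2)
  have hproj : Continuous (Set.projIcc (0 : ℝ) 1 zero_le_one) := continuous_projIcc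
  have hκ : ContinuousOn κ (U ×ˢ Set.univ) :=
    (hr.comp continuousOn_fst fun p hp => hp.1).prodMk (hproj.comp continuous_snd).continuousOn
  have hκ0 : ∀ y, κ (y, 0) = (r y, 0) := fun y => Prod.ext rfl (Set.projIcc_left zero_le_one)
  have hκ1 : ∀ y, κ (y, 1) = (r y, 1) := fun y => Prod.ext rfl (Set.projIcc_right zero_le_one)
  -- The homotopy is `x - s (Φ (r x, t))`, with `t` clamped to `[0, 1]`. The last condition in `O`
  -- forces its slice at time 0 into `Ω` and loses no zeros, since `Ω` contains all of them at time
  -- 0.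
  refine hasBrouwerDegree_zero_of_homotopy hΩo hΩb ?_
    (g := fun p => p.1 - s (Φ (κ p)))
    (O := (U ×ˢ Set.univ ∩ κ ⁻¹' S) ∩ {p | 0 < p.2 ∨ p.1 ∈ Ω}) ?_ ?_ ?_ ?_ ?_ ?_
  · refine continuousOn_id.sub (hs.comp_continuousOn (f.continuous.comp_continuousOn ?_))
    exact hr.mono fun y hy => (hΩU y hy).1
  · exact (hκ.isOpen_inter_preimage (hU.prod isOpen_univ) hSo).inter
      ((isOpen_lt continuous_const continuous_snd).union (hΩo.preimage continuous_fst))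
  · refine continuousOn_fst.sub (hs.comp_continuousOn (Φ.continuous.comp_continuousOn ?_))
    exact hκ.mono fun p hp => hp.1.1
  · have hC : IsCompact (closure S ∩ {q | e (Φ q) = q.1}) :=
      (isClosed_closure.inter (isClosed_eq (by fun_prop) (by fun_prop))).isCompact
    convert hC.image (f := fun q : Z × I => (s (Φ q), (q.2 : ℝ))) (by fun_prop) using 1
    ext ⟨y, t⟩
    constructor
    · rintro ⟨⟨⟨-, hyS⟩, -⟩, ht, hy⟩
      rw [sub_eq_zero] at hy
      refine ⟨κ (y, t), ⟨subset_closure hyS, ?_⟩, Prod.ext hy.symm ?_⟩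
      · change e (Φ (κ (y, t))) = r y
        rw [← hrs, ← hy]
      · exact congrArg Subtype.val (Set.projIcc_of_mem zero_le_one ht)
    · rintro ⟨⟨z, τ⟩, ⟨hqS, hq⟩, hqy⟩
      obtain ⟨rfl, rfl⟩ := Prod.mk.inj hqy
      have hz : r (s (Φ (z, τ))) = z := by rw [hrs]; exact hq
      have hκz : κ (s (Φ (z, τ)), (τ : ℝ)) = (z, τ) :=
        Prod.ext hz (Set.projIcc_val zero_le_one τ)
      have hzS : (z, τ) ∈ S := (heS _ hqS hq).1
      refine ⟨⟨⟨⟨hsU _, trivial⟩, ?_⟩, ?_⟩, τ.2, ?_⟩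
      · change κ _ ∈ S
        rwa [hκz]
      · rcases τ.2.1.eq_or_lt with h0 | h0
        · right
          obtain rfl : τ = 0 := Subtype.ext h0.symm
          refine hΩ _ (hsU _) ?_ ?_
          · change (r (s (Φ (z, 0))), (0 : I)) ∈ S
            rwa [hz]
          · rw [hz, hΦ0]
        · exact Or.inl h0
      · simp only [hκz, sub_self]
  · rintro y ⟨⟨-, hyS⟩, -⟩ hy
    simp only [hκ1, sub_eq_zero] at hy
    have hyS : (r y, (1 : I)) ∈ S := by
      rw [← hκ1]; exact hyS
    refine (heS _ (subset_closure hyS) ?_).2 rfl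
    rw [← hrs, ← hy]
  · rintro y ⟨-, hy⟩
    exact ⟨hy.resolve_left (lt_irrefl _), by simp only [hκ0, hΦ0]⟩
  · intro y hy hy0
    obtain ⟨hyU, hyV⟩ := hΩU y hy
    refine ⟨⟨⟨hyU, trivial⟩, ?_⟩, Or.inr (hΩ y hyU hyV (sub_eq_zero.1 hy0).symm)⟩
    change κ (y, 0) ∈ S
    rw [hκ0]
    exact hyV

/-- An essential fixed point class of `f` is related by a homotopy from `f` to `h` to a fixed point of
`h`. -/
theorem ContinuousMap.Homotopy.exists_path_of_fixedPointIndex_ne_zero [CompactSpace Z] [T2Space Z]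
    (hZ : LocallyEquiconnected Z) (H : f.Homotopy h) {W : Set Z} (hW : IsFixedPointClass f W)
    (hne : fixedPointIndex f W ≠ 0) :
    ∃ (x a : Z) (hx : f x = x) (ha : h a = a) (α : Path x a), x ∈ W ∧ α.Homotopic
      (((α.map f.continuous).cast hx.symm rfl).trans (H.track a ha)) := by
  obtain ⟨x, hx, rfl⟩ := hW
  have hrel : ∃ a, CoincidenceEquiv H.swapped ⟨Prod.fst, continuous_fst⟩ (x, 0) (a, 1) := by
    by_contra! hno
    have h0 := H.hasFixedPointIndex_zero hZ hno
    refine hne ?_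
    -- Either the index is the unique admissible value, hence the admissible value 0, or it is the
    -- default 0.
    unfold fixedPointIndex
    split_ifs with hex
    · exact hex.unique hex.choose_spec.1 h0
    · rfl
  obtain ⟨a, hc⟩ := hrel
  have ha : h a = a := (H.apply_one a).symm.trans hc.2.1
  obtain ⟨α, hα⟩ := H.exists_path_of_coincidenceEquiv hc hx ha
  exact ⟨x, a, hx, ha, α, ⟨hx, hx, Path.refl x, by
    exact (Path.Homotopic.refl _).congr_apply rfl rfl (fun t => rfl) fun t => by simp [hx]⟩, hα⟩

end Homotopy

/-! ### Fixed point sets of `G`-ANRs -/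

section GANR

variable (G : Type v) [Group G] [TopologicalSpace G] {X : Type u}
  [TopologicalSpace X] [MulAction G X] [ContinuousSMul G X]

variable (X) in
/-- The action of `G` by translation on the continuous functions on `X`. -/
abbrev ContinuousMap.translationAction : MulAction G C(X, ℝ) where
  smul g φ := ⟨fun x => φ (g⁻¹ • x), by fun_prop⟩
  one_smul φ := by
    ext x
    change φ ((1 : G)⁻¹ • x) = φ x
    simp
  mul_smul g k φ := by
    ext x
    change φ ((g * k)⁻¹ • x) = φ (k⁻¹ • g⁻¹ • x)
    rw [mul_inv_rev, mul_smul]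

theorem ContinuousMap.continuousSMul_translationAction [IsTopologicalGroup G] [CompactSpace X]
    [T2Space X] :
    letI := ContinuousMap.translationAction G X
    ContinuousSMul G C(X, ℝ) := by
  let := ContinuousMap.translationAction G X
  refine ⟨ContinuousMap.continuous_of_continuous_uncurry _ ?_⟩
  change Continuous fun q : (G × C(X, ℝ)) × X => q.1.2 (q.1.1⁻¹ • q.2)
  fun_prop

/-- A compact metrizable `G`-space has an invariant continuous metric. -/
theorem exists_invariant_dist [CompactSpace G] [CompactSpace X]
    [TopologicalSpace.MetrizableSpace X] :
    ∃ d : X × X → ℝ, Continuous d ∧ (∀ x, d (x, x) = 0) ∧ (∀ x y, d (x, y) = 0 → x = y) ∧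
      ∀ (g : G) x y, d (g • x, g • y) = d (x, y) := by
  let := TopologicalSpace.metrizableSpaceMetric X
  -- The invariant metric is the supremum over `g` of `dist (g • x) (g • y)`, the sup norm of the
  -- curried map.
  let F : C((X × X) × G, ℝ) := ⟨fun q => dist (q.2 • q.1.1) (q.2 • q.1.2), by fun_prop⟩
  have hle : ∀ (g : G) x y, ‖F.curry (g • x, g • y)‖ ≤ ‖F.curry (x, y)‖ := by
    intro g x y
    refine (ContinuousMap.norm_le _ (norm_nonneg _)).2 fun k => ?_
    have := (F.curry (x, y)).norm_coe_le_norm (k * g)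
    simpa [F, mul_smul] using this
  refine ⟨fun p => ‖F.curry p‖, by fun_prop, fun x => ?_, fun x y h => ?_, fun g x y => ?_⟩
  · rw [norm_eq_zero]
    ext k
    simp [F]
  · have h1 := congrArg (fun φ => φ (1 : G)) (norm_eq_zero.1 h)
    simpa [F] using h1
  · refine le_antisymm (hle g x y) ?_
    simpa using hle g⁻¹ (g • x) (g • y)

-- The map `x ↦ d (x, ·)` for an invariant metric embeds `X` equivariantly in the linear `G`-space
-- `C(X, ℝ)`, where `X` is an equivariant neighbourhood retract. Retracting straight segments
-- between `K`-fixed points gives the connecting paths; they stay in `X^K` because such segments are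
-- `K`-fixed.
variable {G} in
theorem IsGANR.locallyEquiconnected_fixedPoints [IsTopologicalGroup G] [CompactSpace G]
    [CompactSpace X] [Nonempty X] (hX : IsGANR G X) (K : Subgroup G) : LocallyEquiconnected (MulAction.fixedPoints K X) := by
  obtain ⟨hmet, hret⟩ := hX
  obtain ⟨d, hd, hd0, hdeq, hdinv⟩ := exists_invariant_dist G (X := X)
  let := ContinuousMap.translationAction G X
  have := ContinuousMap.continuousSMul_translationAction G (X := X)
  have hsmul : ∀ (g : G) (φ : C(X, ℝ)) (x : X), (g • φ) x = φ (g⁻¹ • x) := fun _ _ _ => rfl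
  let e : C(X, C(X, ℝ)) := (⟨d, hd⟩ : C(X × X, ℝ)).curry
  have he : ∀ x y, e x y = d (x, y) := fun _ _ => rfl
  have heg : ∀ (g : G) (x : X), e (g • x) = g • e x := by
    intro g x
    ext y
    rw [hsmul, he, he, ← hdinv g x, smul_inv_smul]
  have hinj : Function.Injective e := fun x y hxy => by
    refine hdeq x y ?_
    rw [← he, hxy, he, hd0]
  obtain ⟨U, r, hU, -, hr, hre⟩ := hret C(X, ℝ) e (e.continuous.isClosedEmbedding hinj) heg
  classical
  let r' : C(X, ℝ) → X := fun φ => if h : φ ∈ U then r ⟨φ, h⟩ else Classical.arbitrary X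
  have hr'U : ∀ φ (h : φ ∈ U), r' φ = r ⟨φ, h⟩ := fun φ h => dif_pos h
  have hr' : ContinuousOn r' U := by
    rw [continuousOn_iff_continuous_domRestrict]
    convert r.continuous using 1
    ext φ
    exact hr'U φ φ.2
  have hr'e : ∀ x, r' (e x) = x := fun x => by
    obtain ⟨hx, hrx⟩ := hre x
    rw [hr'U _ hx, hrx]
  have heU : ∀ x, e x ∈ U := fun x => (hre x).1
  let seg : (MulAction.fixedPoints K X × MulAction.fixedPoints K X) × I → C(X, ℝ) :=
    fun q => (1 - q.2 : ℝ) • e q.1.1 + (q.2 : ℝ) • e q.1.2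
  have hseg : Continuous seg := by fun_prop
  have hsegfix : ∀ q, seg q ∈ U → r' (seg q) ∈ MulAction.fixedPoints K X := by
    intro q hq k
    have hek : ∀ (x : MulAction.fixedPoints K X) y, e x ((k : G)⁻¹ • y) = e x y := by
      intro x y
      have hx : (k : G) • (x : X) = x := x.2 k
      rw [← hsmul, ← heg, hx]
    have hk : seg q = (k : G) • seg q := by
      ext y
      rw [hsmul]
      simp only [seg, ContinuousMap.add_apply, ContinuousMap.smul_apply, hek]
    rw [hr'U _ hq]
    exact (hr k ⟨seg q, hq⟩ ⟨seg q, hq⟩ hk).symm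
  let l : (MulAction.fixedPoints K X × MulAction.fixedPoints K X) × I → MulAction.fixedPoints K X :=
    fun q => if h : seg q ∈ U then ⟨r' (seg q), hsegfix q h⟩ else q.1.1
  have hlval : ∀ q, seg q ∈ U → (l q : X) = r' (seg q) := fun q h => by simp only [l, dif_pos h]
  have hsegdiag : ∀ z t, seg ((z, z), t) = e z := fun z t => by
    simp only [seg, ← add_smul]
    simp
  -- `D` consists of the pairs whose whole segment lies in `U`; compactness of `I` makes it open.
  refine ⟨{p | ∀ t, seg (p, t) ∈ U}, l, ?_, fun z t => ?_, ?_, fun p hp => ?_, fun p hp => ?_,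
    fun z t => ?_⟩
  · rw [isOpen_iff_mem_nhds]
    intro p hp
    have := isCompact_univ.eventually_forall_of_forall_eventually (x₀ := p)
      (P := fun p t => seg (p, t) ∈ U) (K := (Set.univ : Set I)) fun t _ =>
        hseg.continuousAt.eventually (hU.mem_nhds (hp t))
    filter_upwards [this] with q hq t using hq t trivial
  · rw [hsegdiag]
    exact heU z
  · rw [Topology.IsInducing.subtypeVal.continuousOn_iff]
    refine (hr'.comp hseg.continuousOn fun q hq => hq.1 q.2).congr fun q hq => ?_
    exact hlval q (hq.1 q.2)
  · apply Subtype.ext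
    rw [hlval _ (hp 0)]
    simp [seg, hr'e]
  · apply Subtype.ext
    rw [hlval _ (hp 1)]
    simp [seg, hr'e]
  · apply Subtype.ext
    rw [hlval _ (by rw [hsegdiag]; exact heU z), hsegdiag, hr'e]

end GANR

/-! ### Proof of the theorem -/

theorem mainTheorem5
    {E : Type*} [NormedAddCommGroup E] [NormedSpace ℝ E] [FiniteDimensional ℝ E]
    {G : Type v} [TopologicalSpace G] [T2Space G] [CompactSpace G] [ChartedSpace E G] [Group G]
    [LieGroup 𝓘(ℝ, E) ∞ G]
    {X : Type u} [TopologicalSpace X] [CompactSpace X] [MulAction G X] [ContinuousSMul G X]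
    (hX : IsGANR G X)
    (A : Set X) (hA_nonempty : A.Nonempty) (hA_closed : IsClosed A)
    (hA_invariant : ∀ (g : G), ∀ a ∈ A, g • a ∈ A)
    (f h : C(X, X)) (hf : ∀ (g : G) (x : X), f (g • x) = g • f x)
    (hh : ∀ (g : G) (x : X), h (g • x) = g • h x)
    (hfh : IsGHomotopic G f h) (hfix : {x | h x = x} = A) :
    ∃ HA : GHomotopyToInclusion G f A, ConditionCG2 hf HA := by
  have : IsTopologicalGroup G := topologicalGroup_of_lieGroup 𝓘(ℝ, E) ∞
  have : TopologicalSpace.MetrizableSpace X := hX.1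
  have : Nonempty X := hA_nonempty.to_type
  obtain ⟨H, hH⟩ := hfh
  have hfixA : ∀ a : X, h a = a ↔ a ∈ A := fun a => by rw [← hfix]; rfl
  let HA : GHomotopyToInclusion G f A :=
    { toHomotopy :=
        { toFun := fun p => H (p.1, p.2)
          continuous_toFun := by fun_prop
          map_zero_left := fun a => by simp
          map_one_left := fun a => by simpa using (hfixA a).2 a.2 }
      equivariant := fun t g y z hyz => by
        change H (t, (z : X)) = g • H (t, (y : X))
        rw [hyz, hH] }
  refine ⟨HA, fun K _ _ F _ hne => ?_⟩
  -- A nonzero sum has a nonzero term, so `F` contains an ordinary class of nonzero index.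
  obtain ⟨W, hW, hWne⟩ := exists_ne_zero_of_finsum_mem_ne_zero hne
  have : CompactSpace (MulAction.fixedPoints K X) := by
    rw [← isCompact_iff_compactSpace]
    refine IsClosed.isCompact ?_
    have : MulAction.fixedPoints K X = ⋂ k : K, {x | (k : G) • x = x} := by
      ext x
      simp [MulAction.mem_fixedPoints, Subgroup.smul_def]
    rw [this]
    exact isClosed_iInter fun k => isClosed_eq (by fun_prop) continuous_id
  let HK : (fixedMap f hf K).Homotopy (fixedMap h hh K) :=
    { toFun := fun p => ⟨H (p.1, p.2), fun k => by
        have hk : (k : G) • (p.2 : X) = p.2 := p.2.2 k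
        change (k : G) • H (p.1, (p.2 : X)) = _
        rw [← hH, hk]⟩
      continuous_toFun := by fun_prop
      map_zero_left := fun x => Subtype.ext (by simp [fixedMap])
      map_one_left := fun x => Subtype.ext (by simp [fixedMap]) }
  obtain ⟨x, a, hx, ha, α, hxW, hα⟩ := HK.exists_path_of_fixedPointIndex_ne_zero
    (hX.locallyEquiconnected_fixedPoints K) hW.1 hWne
  have haA : (a : X) ∈ A := (hfixA a).1 (congrArg Subtype.val ha)
  exact ⟨x, a, hx, haA, α, hW.2 hxW, hα.congr_apply rfl rfl (fun t => rfl) fun t => rfl⟩
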